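/- Let $(X,d)$ be a connected, locally compact, separable metric space which is a local tree: for every $x\in X$ a radius $\iota(x)>0$ is given such that the open ball $B(x,\iota(x))$, with the restricted metric, is a real tree. (A metric space is a real tree if any two points $u,v$ are joined by a unique isometric embedding $\phi_{u,v}:[0,d(u,v)]\to X$ with $\phi_{u,v}(0)=u$, $\phi_{u,v}(d(u,v))=v$, and every injective continuous $\kappa:[0,1]\to X$ has the same image as $\phi_{\kappa(0),\kappa(1)}$.) Assume that $X$ is a uniform local tree: there is $0<\underline\iota\le\operatorname{diam}X$ such that $B(x,\underline\iota)$ is a real tree for every $x\in X$. For $y\in B(x,\iota(x))$ put $]x,y[\,=\phi_{x,y}(]0,d(x,y)[)$, let $\mathcal S=\bigcup_{x}\bigcup_{y\in B(x,\iota(x))}]x,y[$ be the skeleton, and let $\nu$ be the length measure on $\mathcal S$, i.e. the Borel measure with $\nu(]x,y[)=d(x,y)$ for all such $x,y$. Let $m$ be a Radon measure on $X$ with full support for which there are $d_h\ge 1$ and constants $r_0,c_1,c_2>0$ with $c_1r^{d_h}\le m(B(x,r))\le c_2r^{d_h}$ for all $x\in X$ and $0<r<r_0$. A continuous function $f:X\to\mathbb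 R$ is absolutely continuous if for every $x\in X$ there is a function $\partial_xf$ on $\mathcal S\cap B(x,\iota(x))$, $\nu$-integrable along segments, such that $f(u)-f(x)=\int_{]x,u[}\partial_xf\,d\nu$ for all $u\in B(x,\iota(x))$; then $|\partial f|$ denotes the ($\nu$-a.e. unique) function on $\mathcal S$ equal to $|\partial_xf|$ $\nu$-a.e. on each $\mathcal S\cap B(x,\iota(x))$. The space $W^{1,p}(X,m)$ consists of the $f\in L^p(X,m)$ which have an absolutely continuous $m$-representative $\tilde f$ with $|\partial\tilde f|\in L^p(\mathcal S,\nu)$, and one writes $|\partial f|=|\partial\tilde f|$. Theorem 3.12. Let $1<p<\infty$ and $\theta=\frac{(p-1)d_h}{p-1+pd_h}$. There is a finite constant $C$, not depending on $f$, such that for every $f\in W^{1,p}(X,m)$ \[ \|f\|_{L^p(X,m)}\le C\left(\|f\|_{L^p(X,m)}+\|\partial f\|_{L^p(\mathcal S,\nu)}\right)^{\theta}\|f\|_{L^1(X,m)}^{1-\theta}, \] where $\|f\|_{L^1(X,m)}=\infty$, and hence the right-hand side is infinite, if $f\notin L^1(X,m)$. -/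

import Mathlib

open MeasureTheory Set
open scoped ENNReal NNReal

noncomputable section

namespace LocalTree

/-- `φ : [0, d(u,v)] → T` is an isometric embedding with `φ 0 = u` and `φ (d(u,v)) = v`. -/
structure IsGeodesic {T : Type*} [MetricSpace T] (u v : T)
    (φ : Icc (0 : ℝ) (dist u v) → T) : Prop where
  isometry : Isometry φ
  source : φ ⟨0, le_rfl, dist_nonneg⟩ = u
  target : φ ⟨dist u v, dist_nonneg, le_rfl⟩ = v

/-- Real trees: geodesics exist and are unique, and every injective path runs along the geodesic
between its endpoints. -/
structure IsRealTree (T : Type*) [MetricSpace T] : Prop where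
  unique_geodesic : ∀ u v : T, ∃! φ : Icc (0 : ℝ) (dist u v) → T, IsGeodesic u v φ
  loop_free : ∀ κ : unitInterval → T, Continuous κ → Function.Injective κ →
    ∀ φ : Icc (0 : ℝ) (dist (κ 0) (κ 1)) → T, IsGeodesic (κ 0) (κ 1) φ → range κ = range φ

variable {X : Type*} [MetricSpace X]

/-- `X` is a local tree with radius function `ι`: every open ball `B(x, ι x)`, with the metric
restricted from `X`, is a real tree. -/
def IsLocalTree (ι : X → ℝ) : Prop :=
  ∀ x, 0 < ι x ∧ IsRealTree (Metric.ball x (ι x))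

/-- `X` is a uniform local tree: there is `0 < ρ ≤ diam X` such that every ball of radius `ρ`
is a real tree. -/
def IsUniformLocalTree (X : Type*) [MetricSpace X] : Prop :=
  ∃ ρ : ℝ, 0 < ρ ∧ ENNReal.ofReal ρ ≤ Metric.ediam (univ : Set X) ∧
    ∀ x : X, IsRealTree (Metric.ball x ρ)

/-- The open segment `]x,y[ = φ (]0, d(x,y)[)`, where `φ` is the geodesic from `x` to `y`.
(It is only used for `y ∈ B(x, ι x)`; a geodesic from `x` to `y` in `X` then stays in `B(x, ι x)`,
so that it is unique.) -/
def openSeg (x y : X) : Set X :=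
  {z | ∃ φ : Icc (0 : ℝ) (dist x y) → X, IsGeodesic x y φ ∧
    ∃ t : Icc (0 : ℝ) (dist x y), 0 < (t : ℝ) ∧ (t : ℝ) < dist x y ∧ φ t = z}

/-- The skeleton: the union of all `]x,y[` with `y ∈ B(x, ι x)`. -/
def skeleton (ι : X → ℝ) : Set X :=
  ⋃ x : X, ⋃ y ∈ Metric.ball x (ι x), openSeg x y

variable [MeasurableSpace X] [BorelSpace X]

/-- The length measure `ν`: the Borel measure carried by the skeleton which gives every segment
`]x,y[`, `y ∈ B(x, ι x)`, the mass `d(x,y)` (see `lengthMeasure_openSeg`). As a measure it is the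
one-dimensional Hausdorff measure on the skeleton. -/
def lengthMeasure (ι : X → ℝ) : Measure X :=
  (Measure.hausdorffMeasure 1).restrict (skeleton ι)

/-- `g` is a weak gradient `∂_x f` of `f` in `B(x, ι x)`: it is integrable along the segments
issued from `x` (hence along all segments of the ball, which is the local integrability meant
for the length measure) and `f u - f x = ∫_{]x,u[} g dν` for all `u ∈ B(x, ι x)`. -/
def HasWeakGradientAt (ι : X → ℝ) (f : X → ℝ) (x : X) (g : X → ℝ) : Prop :=
  ∀ u ∈ Metric.ball x (ι x), IntegrableOn g (openSeg x u) (lengthMeasure ι) ∧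
    f u - f x = ∫ z in openSeg x u, g z ∂(lengthMeasure ι)

/-- `f ∈ C(X)` is absolutely continuous, i.e. has a weak gradient `∂_x f` in `B(x, ι x)` for all
`x`, and `G = |∂f|`: for every `x`, `G = |∂_x f|` holds `ν`-a.e. on `B(x, ι x)`. -/
def IsACWithAbsGradient (ι : X → ℝ) (f G : X → ℝ) : Prop :=
  Continuous f ∧ ∀ x, ∃ g : X → ℝ, HasWeakGradientAt ι f x g ∧
    ∀ᵐ z ∂(lengthMeasure ι), z ∈ Metric.ball x (ι x) → G z = |g z|

/-- `G = |∂f|` for a function `f` given up to `m`-null sets: `f` has an absolutely continuous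
`m`-representative `f'`, and `G = |∂f'|`. -/
def IsAbsGradient (ι : X → ℝ) (m : Measure X) (f G : X → ℝ) : Prop :=
  ∃ f' : X → ℝ, f' =ᵐ[m] f ∧ IsACWithAbsGradient ι f' G

/-- `f ∈ W^{1,p}(X,m)`: `f ∈ L^p(X,m)` and `|∂f|` exists and is in `L^p(𝓢,ν)`. -/
def MemSobolev (ι : X → ℝ) (m : Measure X) (p : ℝ≥0∞) (f : X → ℝ) : Prop :=
  MemLp f p m ∧ ∃ G : X → ℝ, IsAbsGradient ι m f G ∧ MemLp G p (lengthMeasure ι)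

/-- Uniform volume control: `c Φ(r) ≤ m(B(x,r)) ≤ C Φ(r)` for all `x` and `0 < r < r₀`. -/
def UniformVolumeControl (m : Measure X) (Φ : ℝ → ℝ) : Prop :=
  ∃ r₀ c C : ℝ, 0 < r₀ ∧ 0 < c ∧ 0 < C ∧ ∀ x : X, ∀ r : ℝ, 0 < r → r < r₀ →
    ENNReal.ofReal (c * Φ r) ≤ m (Metric.ball x r) ∧
      m (Metric.ball x r) ≤ ENNReal.ofReal (C * Φ r)

/-- The length measure of a segment is its length. -/
theorem lengthMeasure_openSeg {ι : X → ℝ} (hι : IsLocalTree ι) {x y : X}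
    (hy : y ∈ Metric.ball x (ι x)) :
    lengthMeasure ι (openSeg x y) = ENNReal.ofReal (dist x y) := by
  have hsub : openSeg x y ⊆ skeleton ι := by
    intro z hz
    exact mem_iUnion.2 ⟨x, mem_iUnion₂.2 ⟨y, hy, hz⟩⟩
  have hx : x ∈ Metric.ball x (ι x) := Metric.mem_ball_self (hι x).1
  have hyx : dist x y < ι x := by rw [dist_comm]; exact hy
  obtain ⟨φ, hφ, huniq⟩ := (hι x).2.unique_geodesic ⟨x, hx⟩ ⟨y, hy⟩
  have hφ' : IsGeodesic x y (fun t => (φ t : X)) :=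
    ⟨isometry_subtype_coe.comp hφ.isometry, congrArg Subtype.val hφ.source,
      congrArg Subtype.val hφ.target⟩
  have hseg : openSeg x y = (fun t => (φ t : X)) ''
      (((↑) : Icc (0 : ℝ) (dist x y) → ℝ) ⁻¹' Ioo 0 (dist x y)) := by
    ext z
    constructor
    · rintro ⟨ψ, hψ, t, h0, h1, rfl⟩
      have hmem : ∀ s, ψ s ∈ Metric.ball x (ι x) := by
        intro s
        have h := hψ.isometry.dist_eq s ⟨0, le_rfl, dist_nonneg⟩
        rw [hψ.source, Subtype.dist_eq, Real.dist_eq, sub_zero, abs_of_nonneg s.2.1] at h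
        rw [Metric.mem_ball, h]
        exact lt_of_le_of_lt s.2.2 hyx
      have hψ' : IsGeodesic (⟨x, hx⟩ : Metric.ball x (ι x)) ⟨y, hy⟩
          (fun s => ⟨ψ s, hmem s⟩) :=
        ⟨Isometry.of_dist_eq fun a b => hψ.isometry.dist_eq a b, Subtype.ext hψ.source,
          Subtype.ext hψ.target⟩
      have he := huniq _ hψ'
      exact ⟨t, ⟨h0, h1⟩, congrArg Subtype.val (congrFun he t).symm⟩
    · rintro ⟨t, ⟨h0, h1⟩, rfl⟩
      exact ⟨_, hφ', t, h0, h1, rfl⟩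
  have key : ∀ ψ : Icc (0 : ℝ) (dist x y) → X, Isometry ψ →
      Measure.hausdorffMeasure 1 (ψ '' (((↑) : Icc (0 : ℝ) (dist x y) → ℝ) ⁻¹' Ioo 0 (dist x y)))
        = ENNReal.ofReal (dist x y) := by
    intro ψ hψ
    rw [hψ.hausdorffMeasure_image (Or.inl zero_le_one),
      ← (isometry_subtype_coe (s := Icc (0 : ℝ) (dist x y))).hausdorffMeasure_image
        (Or.inl zero_le_one), Subtype.image_preimage_coe, inter_eq_right.2 Ioo_subset_Icc_self,
      hausdorffMeasure_real, Real.volume_Ioo, sub_zero]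
  rw [lengthMeasure, Measure.restrict_eq_self _ hsub, hseg]
  exact key _ hφ'.isometry

end LocalTree

end

/-! Cover `X` by balls of small radius `r` around a maximal `r`-separated set; volume control bounds
the multiplicity independently of `r`. Hölder along the geodesic from the centre shows that `f`
oscillates on such a ball by at most `r^(1-1/p)` times the `L^p` norm of `|∂f|` there. Comparing
`|f|` with its mean on each ball and summing gives, up to constants, `‖f‖_p^p ≤ r^(-d_h(p-1))
‖f‖_1^p + r^(p-1+d_h) ‖∂f‖_p^p` (`IsACWithAbsGradient.lintegral_rpow_le`).

Put `A = ‖f‖_1` and `B = ‖f‖_p + ‖∂f‖_p`. With `B` in place of `‖∂f‖_p`, the two terms balance at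
`r^(p-1+p d_h) = (A/B)^p`, which produces `θ`. If that radius is too large, then `B` is at most a
constant times `A` and the trivial bound `‖f‖_p ≤ B` suffices
(`le_mul_rpow_mul_rpow_of_forall_radius`).

Two technical points: the gradient identity is given only on segments issued from `x` inside `B(x, ι
x)`, with no lower bound on `ι`, so `rel_of_locally` chains it along arcs; and `G` need not be
measurable, so its integrals are lower integrals. -/

namespace LocalTree

variable {X : Type*} [MetricSpace X]

/-! ### Geodesic arcs in a local tree -/

/-- The segment `]x,y[` can be computed from any geodesic from `x` to `y`. -/
theorem openSeg_eq_image {ι : X → ℝ} (hι : IsLocalTree ι) {x y : X} (hy : dist x y < ι x)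
    {σ : ℝ → X}
    (hσ : ∀ a ∈ Icc 0 (dist x y), ∀ b ∈ Icc 0 (dist x y), dist (σ a) (σ b) = |a - b|)
    (h0 : σ 0 = x) (h1 : σ (dist x y) = y) :
    openSeg x y = σ '' Ioo 0 (dist x y) := by
  have hball : ∀ ψ : Icc (0 : ℝ) (dist x y) → X, IsGeodesic x y ψ →
      ∀ s, ψ s ∈ Metric.ball x (ι x) := by
    intro ψ hψ s
    have h := hψ.isometry.dist_eq s ⟨0, le_rfl, dist_nonneg⟩
    rw [hψ.source, Subtype.dist_eq, Real.dist_eq, sub_zero, abs_of_nonneg s.2.1] at h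
    rw [Metric.mem_ball, h]
    exact s.2.2.trans_lt hy
  have hlift : ∀ ψ (hψ : IsGeodesic x y ψ),
      IsGeodesic (⟨x, Metric.mem_ball_self (hι x).1⟩ : Metric.ball x (ι x))
        ⟨y, by rwa [Metric.mem_ball, dist_comm]⟩ (fun s => ⟨ψ s, hball ψ hψ s⟩) :=
    fun ψ hψ => ⟨Isometry.of_dist_eq fun a b => hψ.isometry.dist_eq a b,
      Subtype.ext hψ.source, Subtype.ext hψ.target⟩
  have hgeo : IsGeodesic x y (fun t : Icc (0 : ℝ) (dist x y) => σ t) :=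
    ⟨Isometry.of_dist_eq fun a b => by rw [hσ a a.2 b b.2, Subtype.dist_eq, Real.dist_eq], h0, h1⟩
  ext z
  constructor
  · rintro ⟨ψ, hψ, t, ht0, ht1, rfl⟩
    have he := ((hι x).2.unique_geodesic ⟨x, Metric.mem_ball_self (hι x).1⟩
      ⟨y, by rwa [Metric.mem_ball, dist_comm]⟩).unique (hlift ψ hψ) (hlift _ hgeo)
    exact ⟨t, ⟨ht0, ht1⟩, congrArg Subtype.val (congrFun he t).symm⟩
  · rintro ⟨t, ht, rfl⟩
    exact ⟨_, hgeo, ⟨t, ht.1.le, ht.2.le⟩, ht.1, ht.2, rfl⟩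

/-- The points of a ball which is a real tree are joined to the centre by a geodesic. -/
theorem exists_arc {x u : X} {ρ : ℝ} (hρ : IsRealTree (Metric.ball x ρ))
    (hu : u ∈ Metric.ball x ρ) :
    ∃ γ : ℝ → X, (∀ a ∈ Icc 0 (dist x u), ∀ b ∈ Icc 0 (dist x u), dist (γ a) (γ b) = |a - b|) ∧
      γ 0 = x ∧ γ (dist x u) = u := by
  have hx : x ∈ Metric.ball x ρ := Metric.mem_ball_self (dist_nonneg.trans_lt hu)
  obtain ⟨φ, hφ, -⟩ := hρ.unique_geodesic ⟨x, hx⟩ ⟨u, hu⟩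
  have hd : (0 : ℝ) ≤ dist x u := dist_nonneg
  refine ⟨fun t => φ (projIcc 0 (dist x u) hd t), fun a ha b hb => ?_, ?_, ?_⟩
  · beta_reduce
    rw [projIcc_of_mem hd ha, projIcc_of_mem hd hb, ← Subtype.dist_eq, hφ.isometry.dist_eq,
      Subtype.dist_eq, Real.dist_eq]
  · beta_reduce
    rw [projIcc_left]
    exact congrArg Subtype.val hφ.source
  · beta_reduce
    rw [projIcc_right]
    exact congrArg Subtype.val hφ.target

theorem measurableSet_arc [MeasurableSpace X] [BorelSpace X] {γ : ℝ → X} {L : ℝ}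
    (hγ : ∀ a ∈ Icc 0 L, ∀ b ∈ Icc 0 L, dist (γ a) (γ b) = |a - b|) {s : Set ℝ}
    (hs : s ⊆ Icc 0 L) (hm : MeasurableSet s) : MeasurableSet (γ '' s) := by
  have hlip : LipschitzOnWith 1 γ s := LipschitzOnWith.of_dist_le_mul fun a ha b hb => by
    rw [hγ a (hs ha) b (hs hb), Real.dist_eq]; simp
  refine hm.image_of_continuousOn_injOn hlip.continuousOn fun a ha b hb hab => ?_
  have := hγ a (hs ha) b (hs hb)
  rw [hab, dist_self, eq_comm, abs_eq_zero] at this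
  linarith

/-! ### Increments of absolutely continuous functions along arcs -/

/-- A transitive relation on an interval which holds near each point holds for the end points. -/
theorem rel_of_locally {R : ℝ → ℝ → Prop} {L : ℝ} (hL : 0 ≤ L)
    (htrans : ∀ a b c, 0 ≤ a → a ≤ b → b ≤ c → c ≤ L → R a b → R b c → R a c)
    (hloc : ∀ t ∈ Icc 0 L, ∃ ε > 0, ∀ s ∈ Icc 0 L, |s - t| < ε → R (min s t) (max s t)) :
    R 0 L := by
  have h00 : R 0 0 := by
    obtain ⟨ε, hε, h⟩ := hloc 0 ⟨le_rfl, hL⟩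
    simpa using h 0 ⟨le_rfl, hL⟩ (by simpa using hε)
  -- Continuous induction: at `sSup S`, the local hypothesis towards the left puts `sSup S` in `S`;
  -- towards the right it passes beyond `sSup S`, unless `sSup S = L`.
  set S : Set ℝ := {s | s ∈ Icc 0 L ∧ R 0 s} with hS
  have hne : S.Nonempty := ⟨0, ⟨le_rfl, hL⟩, h00⟩
  have hbdd : BddAbove S := ⟨L, fun s hs => hs.1.2⟩
  have hc : sSup S ∈ Icc 0 L :=
    ⟨le_csSup hbdd ⟨⟨le_rfl, hL⟩, h00⟩, csSup_le hne fun s hs => hs.1.2⟩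
  obtain ⟨ε, hε, h⟩ := hloc _ hc
  obtain ⟨s, hs, hlt⟩ := exists_lt_of_lt_csSup hne (sub_lt_self (sSup S) hε)
  have hsc : s ≤ sSup S := le_csSup hbdd hs
  have h1 : R s (sSup S) := by
    have := h s hs.1 (by rw [abs_sub_lt_iff]; constructor <;> linarith)
    rwa [min_eq_left hsc, max_eq_right hsc] at this
  have h2 : R 0 (sSup S) := htrans _ _ _ le_rfl hs.1.1 hsc hc.2 hs.2 h1
  rcases hc.2.eq_or_lt with heq | hcL
  · rwa [heq] at h2
  exfalso
  have hlt' : sSup S < min (sSup S + ε / 2) L := lt_min (by linarith) hcL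
  have hmem : min (sSup S + ε / 2) L ∈ Icc 0 L := ⟨hc.1.trans hlt'.le, min_le_right _ _⟩
  have h3 := h _ hmem (by
    rw [abs_of_pos (sub_pos.2 hlt')]
    linarith [min_le_left (sSup S + ε / 2) L])
  rw [min_eq_right hlt'.le, max_eq_left hlt'.le] at h3
  exact absurd (le_csSup hbdd ⟨hmem, htrans _ _ _ le_rfl hc.1 hlt'.le hmem.2 h2 h3⟩)
    (not_le.2 hlt')

variable [MeasurableSpace X] [BorelSpace X]

theorem measurableSet_openSeg {ι : X → ℝ} (hι : IsLocalTree ι) {x u : X} (hu : dist x u < ι x) :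
    MeasurableSet (openSeg x u) := by
  obtain ⟨γ, hγ, h0, h1⟩ := exists_arc (hι x).2 (u := u) (by rwa [Metric.mem_ball, dist_comm])
  rw [openSeg_eq_image hι hu hγ h0 h1]
  exact measurableSet_arc hγ Ioo_subset_Icc_self measurableSet_Ioo

/-- An absolutely continuous function oscillates over a segment issued from `x` by at most the
integral of `|∂f|`. -/
theorem IsACWithAbsGradient.edist_le {ι : X → ℝ} (hι : IsLocalTree ι) {f G : X → ℝ}
    (hf : IsACWithAbsGradient ι f G) {x u : X} (hu : dist x u < ι x) :
    edist (f x) (f u) ≤ ∫⁻ z in openSeg x u, ‖G z‖ₑ ∂(lengthMeasure ι) := by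
  obtain ⟨g, hg, hG⟩ := hf.2 x
  have hsub : openSeg x u ⊆ Metric.ball x (ι x) := by
    rintro z ⟨φ, hφ, t, ht0, ht1, rfl⟩
    have h := hφ.isometry.dist_eq t ⟨0, le_rfl, dist_nonneg⟩
    rw [hφ.source, Subtype.dist_eq, Real.dist_eq, sub_zero, abs_of_pos ht0] at h
    rw [Metric.mem_ball, h]
    exact ht1.trans hu
  calc edist (f x) (f u) = ‖f u - f x‖ₑ := by rw [edist_comm, edist_eq_enorm_sub]
    _ = ‖∫ z in openSeg x u, g z ∂(lengthMeasure ι)‖ₑ := by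
      rw [(hg u (by rwa [Metric.mem_ball, dist_comm])).2]
    _ ≤ ∫⁻ z in openSeg x u, ‖g z‖ₑ ∂(lengthMeasure ι) := enorm_integral_le_lintegral_enorm _
    _ = ∫⁻ z in openSeg x u, ‖G z‖ₑ ∂(lengthMeasure ι) := by
      refine setLIntegral_congr_fun_ae (measurableSet_openSeg hι hu) ?_
      filter_upwards [hG] with z hz hzu
      rw [hz (hsub hzu), Real.enorm_abs]

/-- The increment of an absolutely continuous function over an arc is at most the integral of
`|∂f|` over that arc. -/
theorem IsACWithAbsGradient.edist_le_arc {ι : X → ℝ} (hι : IsLocalTree ι) {f G : X → ℝ}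
    (hf : IsACWithAbsGradient ι f G) {γ : ℝ → X} {L : ℝ} (hL : 0 ≤ L)
    (hγ : ∀ a ∈ Icc 0 L, ∀ b ∈ Icc 0 L, dist (γ a) (γ b) = |a - b|) :
    edist (f (γ 0)) (f (γ L)) ≤ ∫⁻ z in γ '' Ioo 0 L, ‖G z‖ₑ ∂(lengthMeasure ι) := by
  refine rel_of_locally (R := fun s t => edist (f (γ s)) (f (γ t)) ≤
    ∫⁻ z in γ '' Ioo s t, ‖G z‖ₑ ∂(lengthMeasure ι)) hL ?_ ?_
  · intro a b c ha hab hbc hc h1 h2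
    have hs1 : Ioo a b ⊆ Icc 0 L := fun t ht => ⟨ha.trans ht.1.le, (ht.2.le.trans hbc).trans hc⟩
    have hs2 : Ioo b c ⊆ Icc 0 L := fun t ht => ⟨(ha.trans hab).trans ht.1.le, ht.2.le.trans hc⟩
    have hdisj : Disjoint (γ '' Ioo a b) (γ '' Ioo b c) := by
      rw [disjoint_left]
      rintro _ ⟨s, hs, rfl⟩ ⟨t, ht, hst⟩
      have := hγ t (hs2 ht) s (hs1 hs)
      rw [hst, dist_self, eq_comm, abs_eq_zero] at this
      linarith [hs.2, ht.1]
    calc edist (f (γ a)) (f (γ c)) ≤ edist (f (γ a)) (f (γ b)) + edist (f (γ b)) (f (γ c)) :=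
          edist_triangle _ _ _
      _ ≤ _ := add_le_add h1 h2
      _ = ∫⁻ z in γ '' Ioo a b ∪ γ '' Ioo b c, ‖G z‖ₑ ∂(lengthMeasure ι) :=
          (lintegral_union (measurableSet_arc hγ hs2 measurableSet_Ioo) hdisj).symm
      -- The two open arcs can miss `γ b`, so only monotonicity is used here.
      _ ≤ _ := by
          refine lintegral_mono_set (union_subset ?_ ?_)
          · exact image_mono (Ioo_subset_Ioo_right hbc)
          · exact image_mono (Ioo_subset_Ioo_left hab)
  · intro t ht
    refine ⟨ι (γ t), (hι _).1, fun s hs hst => ?_⟩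
    have hd : dist (γ t) (γ s) = |s - t| := by rw [hγ t ht s hs, abs_sub_comm]
    have hmain := hf.edist_le hι (hd.trans_lt hst)
    rcases le_total t s with h | h
    · have hd' : dist (γ t) (γ s) = s - t := by rw [hd, abs_of_nonneg (sub_nonneg.2 h)]
      rw [openSeg_eq_image hι (hd.trans_lt hst) (σ := fun τ => γ (t + τ))
        (fun a ha b hb => by
          rw [hd'] at ha hb
          rw [hγ _ ⟨by linarith [ht.1, ha.1], by linarith [hs.2, ha.2]⟩ _
            ⟨by linarith [ht.1, hb.1], by linarith [hs.2, hb.2]⟩]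
          congr 1; ring) (by simp) (by simp [hd']), hd', ← image_image γ (fun τ => t + τ),
        image_const_add_Ioo, add_zero, add_sub_cancel] at hmain
      simpa [h] using hmain
    · have hd' : dist (γ t) (γ s) = t - s := by rw [hd, abs_sub_comm, abs_of_nonneg (sub_nonneg.2 h)]
      -- The segment must be issued from `γ t`, so for `s ≤ t` the arc is run backwards.
      rw [openSeg_eq_image hι (hd.trans_lt hst) (σ := fun τ => γ (t - τ))
        (fun a ha b hb => by
          rw [hd'] at ha hb
          rw [hγ _ ⟨by linarith [hs.1, ha.2], by linarith [ht.2, ha.1]⟩ _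
            ⟨by linarith [hs.1, hb.2], by linarith [ht.2, hb.1]⟩, abs_sub_comm]
          congr 1; ring) (by simp) (by simp [hd']), hd', ← image_image γ (fun τ => t - τ),
        image_const_sub_Ioo, sub_zero, sub_sub_cancel, edist_comm] at hmain
      simpa [h] using hmain

/-- Hölder needs only this upper bound, which spares showing that the arc lies in the skeleton. -/
theorem lengthMeasure_arc_le (ι : X → ℝ) {γ : ℝ → X} {L : ℝ}
    (hγ : ∀ a ∈ Icc 0 L, ∀ b ∈ Icc 0 L, dist (γ a) (γ b) = |a - b|) :
    lengthMeasure ι (γ '' Ioo 0 L) ≤ ENNReal.ofReal L := by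
  have hlip : LipschitzOnWith 1 γ (Ioo 0 L) := LipschitzOnWith.of_dist_le_mul fun a ha b hb => by
    rw [hγ a (Ioo_subset_Icc_self ha) b (Ioo_subset_Icc_self hb), Real.dist_eq]; simp
  calc lengthMeasure ι (γ '' Ioo 0 L) ≤ Measure.hausdorffMeasure 1 (γ '' Ioo 0 L) :=
        Measure.restrict_apply_le _ _
    _ ≤ (1 : ℝ≥0) ^ (1 : ℝ) * Measure.hausdorffMeasure 1 (Ioo 0 L) :=
        hlip.hausdorffMeasure_image_le zero_le_one
    _ = ENNReal.ofReal L := by simp [hausdorffMeasure_real]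

end LocalTree

/-! ### Lower integrals -/

/-- Hölder's inequality against the constant one, for lower integrals: no measurability of `h` is
needed. -/
theorem lintegral_le_rpow_mul_rpow_measure_univ {α : Type*} [MeasurableSpace α] (μ : Measure α)
    (h : α → ℝ≥0∞) {p : ℝ} (hp : 1 < p) :
    ∫⁻ z, h z ∂μ ≤ (∫⁻ z, h z ^ p ∂μ) ^ (1 / p) * μ univ ^ (1 - 1 / p) := by
  obtain ⟨g, hg, hgh, heq⟩ := exists_measurable_le_lintegral_eq μ h
  have hpq := Real.HolderConjugate.conjExponent hp
  have hq : 1 / p.conjExponent = 1 - 1 / p := by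
    have := hpq.inv_add_inv_eq_one
    simp only [one_div]; linarith
  have := ENNReal.lintegral_mul_le_Lp_mul_Lq μ hpq hg.aemeasurable
    (aemeasurable_const (b := (1 : ℝ≥0∞)))
  simp only [Pi.mul_apply, mul_one, ENNReal.one_rpow, lintegral_const, one_mul, hq] at this
  rw [heq]
  refine this.trans (mul_le_mul_left (ENNReal.rpow_le_rpow (lintegral_mono fun z => ?_) ?_) _)
  · exact ENNReal.rpow_le_rpow (hgh z) (by linarith)
  · positivity

/-- Integrals over a countable family of sets of multiplicity at most `N` add up to at most `N`
times the total integral; again `h` need not be measurable. -/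
theorem tsum_setLIntegral_le {α κ : Type*} [MeasurableSpace α] [Countable κ] (μ : Measure α)
    (h : α → ℝ≥0∞) {B : κ → Set α} (hB : ∀ i, MeasurableSet (B i)) {N : ℝ≥0∞}
    (hN : ∀ z, ∑' i, (B i).indicator (fun _ => (1 : ℝ≥0∞)) z ≤ N) (hNtop : N ≠ ∞) :
    ∑' i, ∫⁻ z in B i, h z ∂μ ≤ N * ∫⁻ z, h z ∂μ := by
  -- The minorants depend on the piece; their countable supremum is a single measurable minorant of
  -- `h`, for which sum and integral can be exchanged.
  choose g hg hgh heq using fun i => exists_measurable_le_lintegral_eq (μ.restrict (B i)) h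
  set s : α → ℝ≥0∞ := fun z => ⨆ i, g i z with hs
  have hsm : Measurable s := Measurable.iSup hg
  calc ∑' i, ∫⁻ z in B i, h z ∂μ ≤ ∑' i, ∫⁻ z in B i, s z ∂μ := by
        refine ENNReal.tsum_le_tsum fun i => ?_
        rw [heq i]
        exact lintegral_mono fun z => le_iSup (fun i => g i z) i
    _ = ∑' i, ∫⁻ z, (B i).indicator (fun _ => 1) z * s z ∂μ := by
        congr 1; ext i
        rw [← lintegral_indicator (hB i)]
        refine lintegral_congr fun z => ?_
        by_cases hz : z ∈ B i <;> simp [hz]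
    _ = ∫⁻ z, ∑' i, (B i).indicator (fun _ => 1) z * s z ∂μ :=
        (lintegral_tsum fun i => ((measurable_const.indicator (hB i)).mul hsm).aemeasurable).symm
    _ ≤ ∫⁻ z, N * s z ∂μ := by
        refine lintegral_mono fun z => ?_
        rw [ENNReal.tsum_mul_right]
        gcongr
        exact hN z
    _ = N * ∫⁻ z, s z ∂μ := lintegral_const_mul' _ _ hNtop
    _ ≤ N * ∫⁻ z, h z ∂μ := by
        gcongr with z
        exact iSup_le fun i => hgh i z

/-! ### Oscillation on balls -/

namespace LocalTree

variable {X : Type*} [MetricSpace X] [MeasurableSpace X] [BorelSpace X]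

/-- The local Poincaré-type estimate: the oscillation of `f` around the centre of a ball. -/
theorem IsACWithAbsGradient.edist_le_ball {ι : X → ℝ} (hι : IsLocalTree ι) {f G : X → ℝ}
    (hf : IsACWithAbsGradient ι f G) {p : ℝ} (hp : 1 < p) {x : X} {r ρ : ℝ}
    (hρ : IsRealTree (Metric.ball x ρ)) (hr : r ≤ ρ) {u : X} (hu : u ∈ Metric.ball x r) :
    edist (f x) (f u) ≤ (∫⁻ z in Metric.ball x r, ‖G z‖ₑ ^ p ∂(lengthMeasure ι)) ^ (1 / p) *
      ENNReal.ofReal r ^ (1 - 1 / p) := by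
  obtain ⟨γ, hγ, h0, h1⟩ := exists_arc hρ (Metric.ball_subset_ball hr hu)
  have hur : dist x u < r := by rwa [dist_comm]
  -- `r` may exceed `ι x`, hence the chained estimate rather than `edist_le`.
  have h := hf.edist_le_arc hι dist_nonneg hγ
  rw [h0, h1] at h
  have hsub : γ '' Ioo 0 (dist x u) ⊆ Metric.ball x r := by
    rintro _ ⟨t, ht, rfl⟩
    have := hγ t (Ioo_subset_Icc_self ht) 0 ⟨le_rfl, dist_nonneg⟩
    rw [h0, sub_zero, abs_of_pos ht.1] at this
    rw [Metric.mem_ball, this]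
    exact ht.2.trans hur
  have hp1 : 1 / p ≤ 1 := by rw [div_le_one (by linarith)]; exact hp.le
  refine h.trans ((lintegral_le_rpow_mul_rpow_measure_univ _ _ hp).trans ?_)
  rw [Measure.restrict_apply_univ]
  have hp2 : 0 ≤ 1 - 1 / p := by linarith
  gcongr
  exact (lengthMeasure_arc_le ι hγ).trans (ENNReal.ofReal_le_ofReal hur.le)

end LocalTree

/-! ### Coverings of bounded multiplicity -/

/-- A separable metric space has a countable maximal `r`-separated set. -/
theorem exists_countable_separated_net (X : Type*) [MetricSpace X]
    [TopologicalSpace.SeparableSpace X] {r : ℝ} (hr : 0 < r) :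
    ∃ T : Set X, T.Countable ∧ T.Pairwise (fun x y => r ≤ dist x y) ∧
      ⋃ x : T, Metric.ball (x : X) r = univ := by
  obtain ⟨T, hT⟩ := zorn_subset {T : Set X | T.Pairwise fun x y => r ≤ dist x y}
    fun c hc hchain => ⟨⋃₀ c, (pairwise_sUnion hchain.directedOn).2 fun s hs => hc hs,
      fun s hs => subset_sUnion_of_mem hs⟩
  have hsep : T.Pairwise fun x y => r ≤ dist x y := hT.prop
  refine ⟨T, ?_, hsep, ?_⟩
  · refine PairwiseDisjoint.countable_of_isOpen (s := fun x => Metric.ball x (r / 2)) ?_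
      (fun _ _ => Metric.isOpen_ball) fun x _ => ⟨x, Metric.mem_ball_self (half_pos hr)⟩
    exact fun x hx y hy hxy => Metric.ball_disjoint_ball (by linarith [hsep hx hy hxy])
  · refine eq_univ_of_forall fun z => ?_
    by_contra hz
    simp only [mem_iUnion, Metric.mem_ball, not_exists, not_lt] at hz
    have hins : (insert z T).Pairwise fun x y => r ≤ dist x y :=
      hsep.insert fun y hy _ => ⟨hz ⟨y, hy⟩, by rw [dist_comm]; exact hz ⟨y, hy⟩⟩
    have hzT : z ∈ T := hT.le_of_ge hins (subset_insert z T) (mem_insert z T)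
    have := hz ⟨z, hzT⟩
    rw [dist_self] at this
    linarith

/-- The balls of radius `r` around an `r`-separated set have bounded multiplicity. -/
theorem tsum_indicator_ball_le {X : Type*} [MetricSpace X] [MeasurableSpace X] [BorelSpace X]
    (m : Measure X) {T : Set X} (hT : T.Countable) {r : ℝ}
    (hsep : T.Pairwise fun x y => r ≤ dist x y) {a b : ℝ≥0∞} (ha : a ≠ 0) (ha' : a ≠ ∞)
    (hlow : ∀ x, a ≤ m (Metric.ball x (r / 2))) (hup : ∀ x, m (Metric.ball x (2 * r)) ≤ b) (z : X) :
    ∑' i : T, (Metric.ball (i : X) r).indicator (fun _ => (1 : ℝ≥0∞)) z ≤ b / a := by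
  rw [ENNReal.le_div_iff_mul_le (Or.inl ha) (Or.inl ha')]
  rcases le_or_gt r 0 with hr | hr
  · have h0 : ∀ i : T, Metric.ball (i : X) r = ∅ := fun i => Metric.ball_eq_empty.2 hr
    simp [h0]
  have := hT.to_subtype
  -- `U i` is the half-radius ball if the ball around `i` covers `z`, and empty otherwise. These
  -- sets are disjoint, inside `B(z, 2r)`, and each nonempty one has mass at least `a`.
  set U : T → Set X := fun i => {w | w ∈ Metric.ball (i : X) (r / 2) ∧ z ∈ Metric.ball (i : X) r}
    with hU
  have hUm : ∀ i, MeasurableSet (U i) := fun i =>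
    Metric.isOpen_ball.measurableSet.inter (MeasurableSet.const _)
  have hdisj : Pairwise (Function.onFun Disjoint U) := by
    intro i j hij
    refine (Metric.ball_disjoint_ball (x := (i : X)) (y := (j : X)) (δ := r / 2) (ε := r / 2)
      ?_).mono (fun w hw => hw.1) (fun w hw => hw.1)
    linarith [hsep i.2 j.2 fun h => hij (Subtype.ext h)]
  calc (∑' i : T, (Metric.ball (i : X) r).indicator (fun _ => (1 : ℝ≥0∞)) z) * a
      = ∑' i : T, (Metric.ball (i : X) r).indicator (fun _ => (1 : ℝ≥0∞)) z * a :=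
        ENNReal.tsum_mul_right.symm
    _ ≤ ∑' i : T, m (U i) := by
        refine ENNReal.tsum_le_tsum fun i => ?_
        by_cases hz : z ∈ Metric.ball (i : X) r
        · have : U i = Metric.ball (i : X) (r / 2) := by ext w; simp [hU, Metric.mem_ball.1 hz]
          simpa [this, hz] using hlow i
        · simp [hz]
    _ = m (⋃ i, U i) := (measure_iUnion hdisj hUm).symm
    _ ≤ m (Metric.ball z (2 * r)) := by
        refine measure_mono (iUnion_subset fun i w hw => ?_)
        have h1 := Metric.mem_ball.1 hw.1
        have h2 := Metric.mem_ball.1 hw.2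
        rw [Metric.mem_ball]
        linarith [dist_triangle_right w z (i : X)]
    _ ≤ b := hup z

/-! ### The estimate at a fixed scale -/

/-- If `f` oscillates on `B` by at most `D` around the value at `x`, its `p`-th moment on `B` is
controlled by its mean and by `D`. -/
theorem setLIntegral_rpow_le_of_edist_le {X : Type*} [MeasurableSpace X] (m : Measure X)
    {B : Set X} (hB : MeasurableSet B) {f : X → ℝ} {x : X} {D : ℝ≥0∞}
    (hD : ∀ u ∈ B, edist (f x) (f u) ≤ D) {p : ℝ} (hp : 1 < p) {a : ℝ≥0∞} (ha : a ≠ 0)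
    (haB : a ≤ m B) (hBtop : m B ≠ ∞) :
    ∫⁻ u in B, ‖f u‖ₑ ^ p ∂m ≤ 2 ^ (p - 1) * (((∫⁻ u, ‖f u‖ₑ ∂m) / a) ^ (p - 1) *
      (∫⁻ u in B, ‖f u‖ₑ ∂m) + (2 * D) ^ p * m B) := by
  have hB0 : m B ≠ 0 := (ha.bot_lt.trans_le haB).ne'
  have hp1 : 0 ≤ p - 1 := by linarith
  set F := ∫⁻ u in B, ‖f u‖ₑ ∂m with hF
  have hcomp : ∀ u v, ‖f u‖ₑ ≤ ‖f v‖ₑ + edist (f u) (f v) := fun u v => by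
    simpa [edist_zero_right, add_comm] using edist_triangle (f u) (f v) 0
  -- Average `‖f x‖ ≤ ‖f u‖ + D` over `u ∈ B`.
  have hx : ‖f x‖ₑ ≤ F / m B + D := by
    have h1 : ‖f x‖ₑ * m B ≤ F + D * m B := by
      rw [← setLIntegral_const, ← setLIntegral_const, ← lintegral_add_right _ measurable_const]
      exact setLIntegral_mono' hB fun u hu => (hcomp x u).trans (by gcongr; exact hD u hu)
    rw [← ENNReal.le_div_iff_mul_le (Or.inl hB0) (Or.inl hBtop), ENNReal.add_div,
      ENNReal.mul_div_cancel_right hB0 hBtop] at h1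
    exact h1
  have hu : ∀ u ∈ B, ‖f u‖ₑ ^ p ≤ 2 ^ (p - 1) * ((F / m B) ^ p + (2 * D) ^ p) := by
    intro u hu
    refine le_trans ?_ (ENNReal.rpow_add_le_mul_rpow_add_rpow _ _ hp.le)
    gcongr
    calc ‖f u‖ₑ ≤ ‖f x‖ₑ + edist (f u) (f x) := hcomp u x
      _ ≤ (F / m B + D) + D := by rw [edist_comm]; exact add_le_add hx (hD u hu)
      _ = F / m B + 2 * D := by ring
  -- Only `p - 1` of the `p` factors are bounded by the global `L¹` norm; the last one stays local,
  -- so that summing over the balls costs just the multiplicity.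
  have hmean : (F / m B) ^ p * m B ≤ ((∫⁻ u, ‖f u‖ₑ ∂m) / a) ^ (p - 1) * F := by
    have : (F / m B) ^ p = (F / m B) ^ (p - 1) * (F / m B) := by
      conv_rhs => rw [← ENNReal.rpow_one (F / m B), ← ENNReal.rpow_mul, one_mul,
        ← ENNReal.rpow_add_of_nonneg _ _ hp1 zero_le_one, sub_add_cancel]
    rw [this, mul_assoc, ENNReal.div_mul_cancel hB0 hBtop]
    gcongr
    exact setLIntegral_le_lintegral _ _
  calc ∫⁻ u in B, ‖f u‖ₑ ^ p ∂m
      ≤ ∫⁻ _ in B, 2 ^ (p - 1) * ((F / m B) ^ p + (2 * D) ^ p) ∂m := setLIntegral_mono' hB hu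
    _ = 2 ^ (p - 1) * ((F / m B) ^ p * m B + (2 * D) ^ p * m B) := by
        rw [setLIntegral_const, mul_assoc, add_mul]
    _ ≤ _ := by gcongr

namespace LocalTree

variable {X : Type*} [MetricSpace X] [MeasurableSpace X] [BorelSpace X]

/-- The scale-`r` estimate: the `p`-th moment of `f` is controlled by its `L¹` norm and the `p`-th
moment of its gradient, with the powers of `r` dictated by the volume of balls. -/
theorem IsACWithAbsGradient.lintegral_rpow_le [TopologicalSpace.SeparableSpace X]
    {ι : X → ℝ} (hι : IsLocalTree ι) {ρ : ℝ} (hρ : ∀ x : X, IsRealTree (Metric.ball x ρ))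
    (m : Measure X) {f G : X → ℝ} (hf : IsACWithAbsGradient ι f G) {p : ℝ} (hp : 1 < p)
    {r : ℝ} (hr : 0 < r) (hrρ : r ≤ ρ) {a b a' b' : ℝ≥0∞}
    (ha : a ≠ 0) (hb : b ≠ ∞) (ha' : a' ≠ 0) (ha'top : a' ≠ ∞) (hb' : b' ≠ ∞)
    (hlow : ∀ x : X, a ≤ m (Metric.ball x r)) (hup : ∀ x : X, m (Metric.ball x r) ≤ b)
    (hlow' : ∀ x : X, a' ≤ m (Metric.ball x (r / 2)))
    (hup' : ∀ x : X, m (Metric.ball x (2 * r)) ≤ b') :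
    ∫⁻ u, ‖f u‖ₑ ^ p ∂m ≤ 2 ^ (p - 1) * (b' / a') *
      (((∫⁻ u, ‖f u‖ₑ ∂m) / a) ^ (p - 1) * (∫⁻ u, ‖f u‖ₑ ∂m) +
        2 ^ p * ENNReal.ofReal r ^ (p - 1) * b *
          ∫⁻ z, ‖G z‖ₑ ^ p ∂(lengthMeasure ι)) := by
  obtain ⟨T, hT, hsep, hcov⟩ := exists_countable_separated_net X hr
  have := hT.to_subtype
  have hp0 : 0 < p := by linarith
  have hN : b' / a' ≠ ∞ := ENNReal.div_ne_top hb' ha'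
  have hmult := tsum_indicator_ball_le m hT hsep ha' ha'top hlow' hup'
  have hBm : ∀ i : T, MeasurableSet (Metric.ball (i : X) r) :=
    fun i => Metric.isOpen_ball.measurableSet
  set A := ∫⁻ u, ‖f u‖ₑ ∂m with hA
  set E : T → ℝ≥0∞ := fun i => ∫⁻ z in Metric.ball (i : X) r, ‖G z‖ₑ ^ p ∂(lengthMeasure ι)
  have hball : ∀ i : T, ∫⁻ u in Metric.ball (i : X) r, ‖f u‖ₑ ^ p ∂m ≤
      2 ^ (p - 1) * ((A / a) ^ (p - 1) * (∫⁻ u in Metric.ball (i : X) r, ‖f u‖ₑ ∂m) +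
        2 ^ p * ENNReal.ofReal r ^ (p - 1) * b * E i) := by
    intro i
    refine (setLIntegral_rpow_le_of_edist_le m (hBm i)
      (fun u hu => hf.edist_le_ball hι hp (hρ i) hrρ hu) hp ha (hlow i)
      ((hup i).trans_lt hb.lt_top).ne).trans ?_
    refine mul_le_mul_right (add_le_add le_rfl ?_) _
    rw [ENNReal.mul_rpow_of_nonneg _ _ hp0.le, ENNReal.mul_rpow_of_nonneg _ _ hp0.le,
      ← ENNReal.rpow_mul, ← ENNReal.rpow_mul, one_div_mul_cancel hp0.ne', ENNReal.rpow_one,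
      show (1 - 1 / p) * p = p - 1 by field_simp]
    calc _ ≤ 2 ^ p * (E i * ENNReal.ofReal r ^ (p - 1)) * b := by gcongr; exact hup i
      _ = _ := by ring
  calc ∫⁻ u, ‖f u‖ₑ ^ p ∂m = ∫⁻ u in ⋃ i : T, Metric.ball (i : X) r, ‖f u‖ₑ ^ p ∂m := by
        rw [hcov, Measure.restrict_univ]
    _ ≤ ∑' i : T, ∫⁻ u in Metric.ball (i : X) r, ‖f u‖ₑ ^ p ∂m := lintegral_iUnion_le _ _
    _ ≤ _ := ENNReal.tsum_le_tsum hball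
    _ = 2 ^ (p - 1) * ((A / a) ^ (p - 1) * (∑' i : T, ∫⁻ u in Metric.ball (i : X) r, ‖f u‖ₑ ∂m) +
        2 ^ p * ENNReal.ofReal r ^ (p - 1) * b * ∑' i, E i) := by
        rw [ENNReal.tsum_mul_left, ENNReal.tsum_add, ENNReal.tsum_mul_left, ENNReal.tsum_mul_left]
    _ ≤ 2 ^ (p - 1) * ((A / a) ^ (p - 1) * ((b' / a') * A) +
        2 ^ p * ENNReal.ofReal r ^ (p - 1) * b *
          ((b' / a') * ∫⁻ z, ‖G z‖ₑ ^ p ∂(lengthMeasure ι))) := by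
        gcongr
        · exact tsum_setLIntegral_le m _ hBm hmult hN
        · exact tsum_setLIntegral_le _ _ hBm hmult hN
    _ = _ := by ring

end LocalTree

/-! ### Choice of the radius -/

/-- Optimization of the radius in a two-term estimate valid for small radii. -/
theorem le_mul_rpow_mul_rpow_of_forall_radius {p d θ R c C K : ℝ} (hp : 1 < p) (hd : 0 < d)
    (hθ : θ = (p - 1) * d / (p - 1 + p * d)) (hR : 0 < R) (hc : 0 < c) (hC : 0 < C) (hK : 0 < K) :
    ∃ M : ℝ, 0 < M ∧ ∀ x A B : ℝ, 0 ≤ x → x ≤ B → 0 < A → 0 < B →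
      (∀ r, 0 < r → r < R → x ^ p ≤ K * ((A / (c * r ^ d)) ^ (p - 1) * A +
        2 ^ p * r ^ (p - 1) * (C * r ^ d) * B ^ p)) → x ≤ M * B ^ θ * A ^ (1 - θ) := by
  have he : 0 < p - 1 + p * d := by nlinarith
  have hθ' : 1 - θ = (p - 1 + d) / (p - 1 + p * d) := by rw [hθ]; field_simp; ring
  have hθ1 : 0 ≤ 1 - θ := by rw [hθ']; exact div_nonneg (by linarith) he.le
  have hp0 : 0 < p := by linarith
  set e := p - 1 + p * d with he_def
  set M₁ := (K * ((1 / c) ^ (p - 1) + 2 ^ p * C)) ^ (1 / p) with hM₁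
  set M₂ := ((1 / R) ^ (e / p)) ^ (1 - θ) with hM₂
  have h1 : 0 < M₁ := by positivity
  have h2 : 0 < M₂ := by positivity
  have hM₁p : M₁ ^ p = K * ((1 / c) ^ (p - 1) + 2 ^ p * C) := by
    rw [hM₁, ← Real.rpow_mul (by positivity), one_div_mul_cancel hp0.ne', Real.rpow_one]
  refine ⟨M₁ + M₂, by positivity, fun x A B hx hxB hA hB h => ?_⟩
  have hBθ : 0 < B ^ θ := by positivity
  have hAθ : 0 < A ^ (1 - θ) := by positivity
  -- This radius makes both terms multiples of `(B ^ θ * A ^ (1 - θ)) ^ p`; `M₁` collects their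
  -- coefficients.
  set r := (A / B) ^ (p / e) with hr
  have hr0 : 0 < r := by positivity
  have hlr : Real.log r = p / e * (Real.log A - Real.log B) := by
    rw [hr, Real.log_rpow (by positivity), Real.log_div hA.ne' hB.ne']
  rcases lt_or_ge r R with hrR | hrR
  · have key : x ^ p ≤ (M₁ * B ^ θ * A ^ (1 - θ)) ^ p := by
      refine (h r hr0 hrR).trans (le_of_eq ?_)
      rw [Real.mul_rpow (by positivity) hAθ.le, Real.mul_rpow h1.le hBθ.le, hM₁p,
        show A / (c * r ^ d) = (1 / c) * (A / r ^ d) by field_simp,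
        Real.mul_rpow (by positivity) (by positivity)]
      have e1 : (A / r ^ d) ^ (p - 1) * A = (B ^ θ) ^ p * (A ^ (1 - θ)) ^ p := by
        -- After taking logarithms this is a linear identity in `log A` and `log B`.
        refine Real.log_injOn_pos (mem_Ioi.2 (by positivity)) (mem_Ioi.2 (by positivity)) ?_
        rw [Real.log_mul (by positivity) (by positivity), Real.log_mul (by positivity)
          (by positivity), Real.log_rpow (by positivity : 0 < A / r ^ d),
          Real.log_rpow (by positivity : 0 < B ^ θ), Real.log_rpow (by positivity : 0 < A ^ (1 - θ)),
          Real.log_rpow hA, Real.log_rpow hB,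
          Real.log_div (by positivity) (by positivity), Real.log_rpow hr0, hlr, hθ', hθ]
        field_simp
        rw [he_def]; ring
      have e2 : r ^ (p - 1) * r ^ d * B ^ p = (B ^ θ) ^ p * (A ^ (1 - θ)) ^ p := by
        refine Real.log_injOn_pos (mem_Ioi.2 (by positivity)) (mem_Ioi.2 (by positivity)) ?_
        rw [Real.log_mul (by positivity) (by positivity), Real.log_mul (by positivity)
          (by positivity), Real.log_mul (by positivity) (by positivity),
          Real.log_rpow (by positivity : 0 < B ^ θ), Real.log_rpow (by positivity : 0 < A ^ (1 - θ)),
          Real.log_rpow hA, Real.log_rpow hB, Real.log_rpow hB,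
          Real.log_rpow hr0, Real.log_rpow hr0, hlr, hθ', hθ]
        field_simp
        rw [he_def]; ring
      linear_combination K * (1 / c) ^ (p - 1) * e1 + K * 2 ^ p * C * e2
    have := (Real.rpow_le_rpow_iff hx (by positivity) hp0).1 key
    refine this.trans ?_
    gcongr
    linarith
  -- The radius is not admissible, but then `A / B` is bounded below and `x ≤ B` is enough, with
  -- constant `M₂`.
  · have hBA : B ≤ A * (1 / R) ^ (e / p) := by
      have h3 : R ^ (e / p) ≤ A / B := by
        calc R ^ (e / p) ≤ r ^ (e / p) := by gcongr
          _ = A / B := by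
            rw [hr, ← Real.rpow_mul (by positivity), show p / e * (e / p) = 1 by field_simp,
              Real.rpow_one]
      rw [Real.div_rpow zero_le_one hR.le, Real.one_rpow, mul_one_div, le_div_iff₀ (by positivity)]
      rw [le_div_iff₀ hB] at h3
      linarith
    calc x ≤ B := hxB
      _ = B ^ θ * B ^ (1 - θ) := by rw [← Real.rpow_add hB, add_sub_cancel, Real.rpow_one]
      _ ≤ B ^ θ * (A * (1 / R) ^ (e / p)) ^ (1 - θ) := by gcongr
      _ = M₂ * B ^ θ * A ^ (1 - θ) := by
        rw [Real.mul_rpow hA.le (by positivity)]; ring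
      _ ≤ _ := by gcongr; linarith

/-! ### The interpolation inequality -/

theorem theorem3p12 {X : Type*} [MetricSpace X] [MeasurableSpace X] [BorelSpace X]
    [ConnectedSpace X] [LocallyCompactSpace X] [TopologicalSpace.SeparableSpace X]
    (ι : X → ℝ) (hι : LocalTree.IsLocalTree ι) (hunif : LocalTree.IsUniformLocalTree X)
    (m : Measure X) [m.Regular] [m.IsOpenPosMeasure]
    (d_h : ℝ) (hd : 1 ≤ d_h)
    (hvol : LocalTree.UniformVolumeControl m (fun r => r ^ d_h))
    (p : ℝ) (hp : 1 < p)
    (θ : ℝ) (hθ : θ = (p - 1) * d_h / (p - 1 + p * d_h)) :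
    ∃ C : ℝ≥0, ∀ f : X → ℝ, LocalTree.MemSobolev ι m (ENNReal.ofReal p) f →
      ∀ G : X → ℝ, LocalTree.IsAbsGradient ι m f G →
        eLpNorm f (ENNReal.ofReal p) m ≤
          C * (eLpNorm f (ENNReal.ofReal p) m +
            eLpNorm G (ENNReal.ofReal p) (LocalTree.lengthMeasure ι)) ^ θ *
          (eLpNorm f 1 m) ^ (1 - θ) := by
  obtain ⟨ρ, hρ, -, htree⟩ := hunif
  obtain ⟨r₀, c, C, hr₀, hc, hC, hball⟩ := hvol
  beta_reduce at hball
  have hp0 : 0 < p := by linarith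
  have hd0 : 0 < d_h := by linarith
  have he : 0 < p - 1 + p * d_h := by nlinarith
  have hθ0 : 0 < θ := by rw [hθ]; exact div_pos (mul_pos (by linarith) hd0) he
  have hθ1 : 0 < 1 - θ := by
    rw [hθ, sub_pos, div_lt_one he]; nlinarith
  -- `C / c * 4 ^ d_h` is the multiplicity bound: the ratio of the volume bounds at radii `2 * r`
  -- and `r / 2`.
  set K : ℝ := 2 ^ (p - 1) * (C / c * 4 ^ d_h) with hK
  have hK0 : 0 < K := by positivity
  -- Balls of radius `r` must be trees and those of radius `2 * r` must obey the volume bound, hence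
  -- `min ρ (r₀ / 2)`.
  obtain ⟨M, hM, hopt⟩ := le_mul_rpow_mul_rpow_of_forall_radius hp hd0 hθ
    (lt_min hρ (half_pos hr₀)) hc hC hK0
  have hpne : ENNReal.ofReal p ≠ 0 := by simpa using hp0
  have hpow : ∀ (μ : Measure X) (h : X → ℝ),
      eLpNorm h (ENNReal.ofReal p) μ ^ p = ∫⁻ x, ‖h x‖ₑ ^ p ∂μ := fun μ h => by
    rw [eLpNorm_eq_lintegral_rpow_enorm_toReal hpne ENNReal.ofReal_ne_top,
      ENNReal.toReal_ofReal hp0.le, ← ENNReal.rpow_mul, one_div_mul_cancel hp0.ne',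
      ENNReal.rpow_one]
  refine ⟨M.toNNReal, ?_⟩
  rintro f - G ⟨f', hff', hf'⟩
  rw [← eLpNorm_congr_ae hff', ← eLpNorm_congr_ae hff']
  set x := eLpNorm f' (ENNReal.ofReal p) m with hx
  set g := eLpNorm G (ENNReal.ofReal p) (LocalTree.lengthMeasure ι) with hg
  set A := eLpNorm f' 1 m with hA
  have hM' : (M.toNNReal : ℝ≥0∞) ≠ 0 := by simpa using hM
  -- Since `0 * ∞ = 0` in `ℝ≥0∞`, an infinite norm makes the right side infinite only once `A` and
  -- `x + g` are known to be nonzero.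
  rcases eq_or_ne x 0 with hx0 | hx0
  · rw [hx0]; exact zero_le
  have hf'0 : ¬ f' =ᵐ[m] 0 := fun h => hx0 (by rw [hx, eLpNorm_congr_ae h, eLpNorm_zero])
  have hA0 : A ≠ 0 := fun h =>
    hf'0 ((eLpNorm_eq_zero_iff hf'.1.aestronglyMeasurable one_ne_zero).1 h)
  have hB0 : x + g ≠ 0 := fun h => hx0 (add_eq_zero.1 h).1
  rcases eq_or_ne A ∞ with hAtop | hAtop
  · rw [hAtop, ENNReal.top_rpow_of_pos hθ1, ENNReal.mul_top]
    · exact le_top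
    · exact mul_ne_zero hM' fun h => hB0 ((ENNReal.rpow_eq_zero_iff_of_pos hθ0).1 h)
  rcases eq_or_ne (x + g) ∞ with hBtop | hBtop
  · rw [hBtop, ENNReal.top_rpow_of_pos hθ0, ENNReal.mul_top hM', ENNReal.top_mul]
    · exact le_top
    · exact fun h => hA0 ((ENNReal.rpow_eq_zero_iff_of_pos hθ1).1 h)
  have hxtop : x ≠ ∞ := fun h => hBtop (by simp [h])
  have hscale : ∀ r, 0 < r → r < min ρ (r₀ / 2) →
      x.toReal ^ p ≤ K * ((A.toReal / (c * r ^ d_h)) ^ (p - 1) * A.toReal +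
        2 ^ p * r ^ (p - 1) * (C * r ^ d_h) * (x + g).toReal ^ p) := by
    intro r hr hrR
    have hrρ : r ≤ ρ := (hrR.trans_le (min_le_left _ _)).le
    have hrr₀ : r < r₀ / 2 := hrR.trans_le (min_le_right _ _)
    have hpos : ∀ s : ℝ, 0 < s → 0 < c * s ^ d_h := fun s hs => by positivity
    have h := hf'.lintegral_rpow_le hι htree m hp hr hrρ
      (ENNReal.ofReal_pos.2 (hpos r hr)).ne' ENNReal.ofReal_ne_top
      (ENNReal.ofReal_pos.2 (hpos (r / 2) (half_pos hr))).ne' ENNReal.ofReal_ne_top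
      ENNReal.ofReal_ne_top
      (fun x => (hball x r hr (by linarith)).1) (fun x => (hball x r hr (by linarith)).2)
      (fun x => (hball x (r / 2) (half_pos hr) (by linarith)).1)
      (fun x => (hball x (2 * r) (by linarith) (by linarith)).2)
    have hratio : C * (2 * r) ^ d_h / (c * (r / 2) ^ d_h) = C / c * 4 ^ d_h := by
      rw [show 2 * r = 4 * (r / 2) by ring, Real.mul_rpow (by norm_num) (by positivity)]
      field_simp
    have h2 : ∀ q : ℝ, (2 : ℝ≥0∞) ^ q = ENNReal.ofReal (2 ^ q) := fun q => by
      rw [← ENNReal.ofReal_rpow_of_pos two_pos, ENNReal.ofReal_ofNat]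
    rw [← hpow, ← hpow, ← eLpNorm_one_eq_lintegral_enorm] at h
    have h' : x ^ p ≤ ENNReal.ofReal (K * ((A.toReal / (c * r ^ d_h)) ^ (p - 1) * A.toReal +
        2 ^ p * r ^ (p - 1) * (C * r ^ d_h) * (x + g).toReal ^ p)) := by
      refine h.trans ?_
      rw [← ENNReal.ofReal_div_of_pos (hpos _ (half_pos hr)), hratio, h2, h2,
        ← ENNReal.ofReal_mul (by positivity), ← hK,
        ENNReal.ofReal_rpow_of_pos hr, ← ENNReal.ofReal_mul (by positivity),
        ← ENNReal.ofReal_mul (by positivity), ENNReal.ofReal_mul hK0.le,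
        ENNReal.ofReal_add (by positivity) (by positivity),
        ENNReal.ofReal_mul (p := (A.toReal / (c * r ^ d_h)) ^ (p - 1)) (by positivity),
        ENNReal.ofReal_mul (p := 2 ^ p * r ^ (p - 1) * (C * r ^ d_h)) (by positivity),
        ← ENNReal.ofReal_rpow_of_nonneg (x := A.toReal / (c * r ^ d_h))
          (by positivity) (by linarith : 0 ≤ p - 1),
        ← ENNReal.ofReal_rpow_of_nonneg (x := (x + g).toReal) (by positivity) hp0.le,
        ENNReal.ofReal_div_of_pos (hpos r hr), ENNReal.ofReal_toReal hAtop,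
        ENNReal.ofReal_toReal hBtop]
      gcongr
      -- The scale estimate involves only `g`; it is enlarged to `x + g`, the quantity `B` of the
      -- optimization.
      exact le_add_self
    rw [ENNReal.toReal_rpow]
    exact ENNReal.toReal_le_of_le_ofReal (by positivity) h'
  have hreal := hopt x.toReal A.toReal (x + g).toReal ENNReal.toReal_nonneg
    (ENNReal.toReal_mono hBtop le_self_add) (ENNReal.toReal_pos hA0 hAtop)
    (ENNReal.toReal_pos hB0 hBtop) hscale
  calc x = ENNReal.ofReal x.toReal := (ENNReal.ofReal_toReal hxtop).symm
    _ ≤ ENNReal.ofReal (M * (x + g).toReal ^ θ * A.toReal ^ (1 - θ)) :=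
      ENNReal.ofReal_le_ofReal hreal
    _ = _ := by
      rw [ENNReal.ofReal_mul (by positivity), ENNReal.ofReal_mul hM.le,
        ← ENNReal.ofReal_rpow_of_nonneg (by positivity) hθ0.le,
        ← ENNReal.ofReal_rpow_of_nonneg (by positivity) hθ1.le,
        ENNReal.ofReal_toReal hBtop, ENNReal.ofReal_toReal hAtop]
      rfl
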